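/- Let $X=(x^1,\dots,x^N)$ be a finite family of points of $\mathbb R^d$ (counted with multiplicity) and let $p\in(0,1)$ with $pN\notin\mathbb Z$. *Notation.* For a scalar family $Y=(y^1,\dots,y^N)$ let $q^-_Y(p)=\min\{a\in\{y^1,\dots,y^N\} : \#\{i : y^i\le a\}\ge\lceil Np\rceil\}$ and $\phi_Y(t)=\sum_{i=1}^N\big(p\,(y^i-t)^+ +(1-p)(y^i-t)^-\big)$, where $y^+=\max\{0,y\}$ and $y^-=\max\{0,-y\}$. For a family $Z$ of points of $\mathbb R^n$ and $w\in\mathbb R^n$ let $w^TZ=(w^Tz^1,\dots,w^Tz^N)$. For a polyhedral convex cone $C\subseteq\mathbb R^n$ with dual cone $C^+=\{w : w^Ty\ge 0\ \forall y\in C\}$, the empirical lower $C$-quantile is $$Q^-_{Z,C}(p)=\bigcap_{w\in C^+}\{z\in\mathbb R^n : w^Tz\ge q^-_{w^TZ}(p)\};$$ for $C=\{0\}$ it is the Tukey depth region. Let $\ell(X)$ be the family of the points $(x^i,-e^Tx^i)\in\mathbb R^{d+1}$, where $e=(1,\dots,1)^T$, and let $C=\mathbb R^{d+1}_+$. Fix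 $c\in\operatorname{int}C$ and put $B^+=\{w\in C^+ : c^Tw=1\}$. Consider the problem $$(\mathrm{VLP}^*)\qquad \min\nolimits_K D(w,t)\quad\text{s.t. } (w,t)\in T:=B^+\times\mathbb R,$$ where $D(w,t)=\big(\tfrac{c_{d+1}}{|c_{d+1}|}w_1,\dots,\tfrac{c_{d+1}}{|c_{d+1}|}w_d,\ \phi_{w^T\ell(X)}(t)\big)$ and $K=\{y\in\mathbb R^{d+1} : y_1=\dots=y_d=0,\ y_{d+1}\ge 0\}$. Call a finite set $\bar T\subseteq T$ a *solution* if $D[\bar T]$ contains all vertices of $D[T]+K$, and *irredundant* if in addition no point of $\bar T$ can be omitted without losing this property. A point $x\in T$ is a *minimizer* if $y\in T$ and $D(x)\in D(y)+K$ imply $D(y)=D(x)$. For $w\in\mathbb R^{d+1}$ let $\lambda(w)=(w_1-w_{d+1},\dots,w_d-w_{d+1})$. *Claim.* $(\mathrm{VLP}^*)$ has a unique irredundant solution. Moreover, if $\bar T$ is the irredundant solution, or more generally any solution all of whose points are minimizers, then $$Q^-_{X,\{0\}}(p)=\bigcap_{(w,t)\in\bar T}\{z\in\mathbb R^d : \lambda(w)^Tz\ge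 t\},$$ and for every solution $\bar T$ all of whose points are minimizers also $$Q^-_{\ell(X),C}(p)=\bigcap_{(w,t)\in\bar T}\{z\in\mathbb R^{d+1} : w^Tz\ge t\}.$$ -/

import Mathlib

open scoped Pointwise

noncomputable section

namespace ConeQuantile

/-- The scalar data `wᵀX = (wᵀx¹, …, wᵀx^N)`. Data are families, counted with multiplicity. -/
def scalarize {n N : ℕ} (w : Fin n → ℝ) (X : Fin N → Fin n → ℝ) : Fin N → ℝ :=
  fun i => w ⬝ᵥ X i

/-- The data values `a` of a scalar sample such that at least `⌈N p⌉` data points are `≤ a`. -/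
def quantileSet {N : ℕ} (X : Fin N → ℝ) (p : ℝ) : Set ℝ :=
  {a | a ∈ Set.range X ∧ ⌈(N : ℝ) * p⌉ ≤ ((Finset.univ.filter fun i => X i ≤ a).card : ℤ)}

/-- The empirical lower `p`-quantile of a scalar sample: the least element of `quantileSet X p`
(see `isLeast_lowerQuantile`). -/
def lowerQuantile {N : ℕ} (X : Fin N → ℝ) (p : ℝ) : ℝ :=
  sInf (quantileSet X p)

/-- For a nonempty sample and `p ≤ 1` the infimum defining the lower quantile is a minimum. -/
theorem isLeast_lowerQuantile {N : ℕ} (hN : 0 < N) (X : Fin N → ℝ) {p : ℝ} (hp : p ≤ 1) :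
    IsLeast (quantileSet X p) (lowerQuantile X p) := by
  have hfin : (quantileSet X p).Finite := (Set.finite_range X).subset fun a ha => ha.1
  have hne : (quantileSet X p).Nonempty := by
    have : Nonempty (Fin N) := ⟨⟨0, hN⟩⟩
    obtain ⟨i, hi⟩ := Finite.exists_max X
    refine ⟨X i, ⟨i, rfl⟩, ?_⟩
    rw [Finset.filter_true_of_mem fun j _ => hi j, Finset.card_univ, Fintype.card_fin, Int.ceil_le]
    push_cast
    exact mul_le_of_le_one_right (Nat.cast_nonneg N) hp
  exact ⟨hne.csInf_mem hfin, fun a ha => csInf_le hfin.bddBelow ha⟩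

/-- The function `φ_X(t) = ∑ i, (p (xⁱ - t)⁺ + (1 - p) (xⁱ - t)⁻)` of a scalar sample, where
`y⁺ = max y 0` and `y⁻ = max (-y) 0`. -/
def phi {N : ℕ} (X : Fin N → ℝ) (p t : ℝ) : ℝ :=
  ∑ i, (p * (X i - t)⁺ + (1 - p) * (X i - t)⁻)

/-- The dual cone `C⁺ = {w | ∀ y ∈ C, 0 ≤ yᵀw}`. -/
def dualCone {n : ℕ} (C : PointedCone ℝ (Fin n → ℝ)) : PointedCone ℝ (Fin n → ℝ) :=
  PointedCone.dual (dotProductBilin ℝ ℝ) (C : Set (Fin n → ℝ))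

/-- The empirical lower `C`-quantile `Q⁻_{X,C}(p)`. -/
def coneQuantile {n N : ℕ} (X : Fin N → Fin n → ℝ) (C : PointedCone ℝ (Fin n → ℝ)) (p : ℝ) :
    Set (Fin n → ℝ) :=
  ⋂ w ∈ dualCone C, {z | lowerQuantile (scalarize w X) p ≤ w ⬝ᵥ z}

/-- The base `B⁺ = {w ∈ C⁺ | cᵀw = 1}` of the dual cone. -/
def dualBase {n : ℕ} (C : PointedCone ℝ (Fin n → ℝ)) (c : Fin n → ℝ) : Set (Fin n → ℝ) :=
  {w | w ∈ dualCone C ∧ c ⬝ᵥ w = 1}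

/-- The feasible set `T = B⁺ × ℝ` of the dual problem `min_K D(w, t)`, `w ∈ B⁺`, `t ∈ ℝ`. -/
def feasibleSet {n : ℕ} (C : PointedCone ℝ (Fin n → ℝ)) (c : Fin n → ℝ) :
    Set ((Fin n → ℝ) × ℝ) :=
  dualBase C c ×ˢ Set.univ

/-- The dual objective function
`D(w, t) = (σ w₁, …, σ w_d, φ_{wᵀX}(t))` on `ℝ^{d+1} × ℝ`, where `σ = c_{d+1} / |c_{d+1}|`. -/
def dualObjective {d N : ℕ} (X : Fin N → Fin (d + 1) → ℝ) (c : Fin (d + 1) → ℝ) (p : ℝ)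
    (wt : (Fin (d + 1) → ℝ) × ℝ) : Fin (d + 1) → ℝ :=
  Fin.snoc (α := fun _ => ℝ)
    (fun j : Fin d => c (Fin.last d) / |c (Fin.last d)| * wt.1 j.castSucc)
    (phi (scalarize wt.1 X) p wt.2)

/-- The ordering cone `K` of the dual problem: all but the last coordinate vanish and the last
one is nonnegative. -/
def orderCone (d : ℕ) : Set (Fin (d + 1) → ℝ) :=
  {y | (∀ j : Fin d, y j.castSucc = 0) ∧ 0 ≤ y (Fin.last d)}

/-- The extended image `D[T] + K` of the dual problem. -/
def extendedImage {d N : ℕ} (X : Fin N → Fin (d + 1) → ℝ) (C : PointedCone ℝ (Fin (d + 1) → ℝ))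
    (c : Fin (d + 1) → ℝ) (p : ℝ) : Set (Fin (d + 1) → ℝ) :=
  dualObjective X c p '' feasibleSet C c + orderCone d

/-- A solution of the dual problem: a finite set of feasible points whose objective values cover
all vertices (extreme points) of the extended image. -/
structure IsSolution {d N : ℕ} (X : Fin N → Fin (d + 1) → ℝ)
    (C : PointedCone ℝ (Fin (d + 1) → ℝ)) (c : Fin (d + 1) → ℝ) (p : ℝ)
    (T : Set ((Fin (d + 1) → ℝ) × ℝ)) : Prop where
  finite : T.Finite
  feasible : T ⊆ feasibleSet C c
  covers : (extendedImage X C c p).extremePoints ℝ ⊆ dualObjective X c p '' T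

/-- A solution is irredundant if after omitting any of its points the vertices of the extended
image are no longer covered. -/
structure IsIrredundantSolution {d N : ℕ} (X : Fin N → Fin (d + 1) → ℝ)
    (C : PointedCone ℝ (Fin (d + 1) → ℝ)) (c : Fin (d + 1) → ℝ) (p : ℝ)
    (T : Set ((Fin (d + 1) → ℝ) × ℝ)) : Prop extends IsSolution X C c p T where
  irredundant : ∀ x ∈ T,
    ¬ (extendedImage X C c p).extremePoints ℝ ⊆ dualObjective X c p '' (T \ {x})

/-- A feasible point `x` is a minimizer of the dual problem if `D(x)` is `K`-minimal in `D[T]`: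
there is no other value `D(y)`, `y` feasible, with `D(x) ∈ D(y) + K`. -/
def IsMinimizer {d N : ℕ} (X : Fin N → Fin (d + 1) → ℝ) (C : PointedCone ℝ (Fin (d + 1) → ℝ))
    (c : Fin (d + 1) → ℝ) (p : ℝ) (x : (Fin (d + 1) → ℝ) × ℝ) : Prop :=
  x ∈ feasibleSet C c ∧ ∀ y ∈ feasibleSet C c,
    dualObjective X c p x - dualObjective X c p y ∈ orderCone d →
      dualObjective X c p y = dualObjective X c p x

/-- The lifted data `ℓ(X)` in `ℝ^{d+1}`, consisting of the points `(x, -eᵀx)`. -/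
def liftData {d N : ℕ} (X : Fin N → Fin d → ℝ) : Fin N → Fin (d + 1) → ℝ :=
  fun i => Fin.snoc (α := fun _ => ℝ) (X i) (-∑ j, X i j)

/-- The unlifted normal `λ(w) = (w₁ - w_{d+1}, …, w_d - w_{d+1})`. -/
def unlift {d : ℕ} (w : Fin (d + 1) → ℝ) : Fin d → ℝ :=
  fun j => w j.castSucc - w (Fin.last d)

/-- The cone `ℝⁿ₊` of componentwise nonnegative vectors. -/
def orthant (n : ℕ) : PointedCone ℝ (Fin n → ℝ) :=
  PointedCone.positive ℝ (Fin n → ℝ)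

end ConeQuantile

end

/-! The loss `φ_{wᵀZ}(t)` is convex and piecewise linear in the pair `(w, t)`. For fixed `w`, its
slopes just left and right of the lower quantile are `#{Y < q} - pN` and `#{Y ≤ q} - pN`. Since `pN`
is not an integer, they are strictly negative and strictly positive, so the quantile is the only
minimizer in `t` (`phi_lowerQuantile_lt`). Hence the minimizers are exactly the feasible quantile
pairs. The objective is injective on these, because `cᵀw = 1` recovers the last weight. Each vertex
therefore has a single feasible preimage. These preimages are determined by sign vectors, hence
finite in number (`eq_of_sign_eq`); they lie in every solution and form the only irredundant one.

For the quantile formula, fix the weak signs of the residuals of a quantile pair. The resulting cell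
is a compact convex set of quantile pairs, and its extreme points map to vertices
(`mem_vertexPairs_of_mem_extremePoints_signCell`), because equality in convexity forces residuals of
equal signs. By Krein–Milman, an inequality `t ≤ wᵀz`, linear in `(w, t)`, passes from the vertices
to all quantile pairs, and by homogeneity to the whole dual cone. The Tukey region follows from
`wᵀ(z, -eᵀz) = λ(w)ᵀz`, since `λ` maps the orthant onto `ℝ^d`. -/

noncomputable section

namespace ConeQuantile

/-! ### Convexity of the asymmetric absolute value and its equality case -/

/-- The asymmetric absolute value `u ↦ p u⁺ + (1 - p) u⁻`. -/
def checkLoss (p u : ℝ) : ℝ := p * u⁺ + (1 - p) * u⁻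

lemma checkLoss_of_nonneg (p : ℝ) {u : ℝ} (hu : 0 ≤ u) : checkLoss p u = p * u := by
  simp [checkLoss, posPart_of_nonneg hu, negPart_of_nonneg hu]

lemma checkLoss_of_nonpos (p : ℝ) {u : ℝ} (hu : u ≤ 0) : checkLoss p u = (p - 1) * u := by
  simp only [checkLoss, posPart_of_nonpos hu, negPart_of_nonpos hu]
  ring

/-- The loss is the maximum of the linear functions `p * u` and `(p - 1) * u`; this bound and the
next are its two supporting lines. -/
lemma le_checkLoss {p : ℝ} (u : ℝ) : p * u ≤ checkLoss p u := by
  rcases le_total 0 u with h | h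
  · rw [checkLoss_of_nonneg p h]
  · rw [checkLoss_of_nonpos p h]; linarith

lemma sub_one_mul_le_checkLoss {p : ℝ} (u : ℝ) : (p - 1) * u ≤ checkLoss p u := by
  rcases le_total 0 u with h | h
  · rw [checkLoss_of_nonneg p h]; linarith
  · rw [checkLoss_of_nonpos p h]

/-- Convexity of the asymmetric absolute value. -/
lemma checkLoss_add_le {p a b : ℝ} (u v : ℝ) (ha : 0 ≤ a) (hb : 0 ≤ b) :
    checkLoss p (a * u + b * v) ≤ a * checkLoss p u + b * checkLoss p v := by
  rcases le_total 0 (a * u + b * v) with h | h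
  · rw [checkLoss_of_nonneg p h]
    nlinarith [mul_le_mul_of_nonneg_left (le_checkLoss (p := p) u) ha,
      mul_le_mul_of_nonneg_left (le_checkLoss (p := p) v) hb]
  · rw [checkLoss_of_nonpos p h]
    nlinarith [mul_le_mul_of_nonneg_left (sub_one_mul_le_checkLoss (p := p) u) ha,
      mul_le_mul_of_nonneg_left (sub_one_mul_le_checkLoss (p := p) v) hb]

/-- The asymmetric absolute value is additive on each of the two half-lines. -/
lemma checkLoss_add_of_same_sign {p a b u v : ℝ} (ha : 0 ≤ a) (hb : 0 ≤ b)
    (h : 0 ≤ u ∧ 0 ≤ v ∨ u ≤ 0 ∧ v ≤ 0) :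
    checkLoss p (a * u + b * v) = a * checkLoss p u + b * checkLoss p v := by
  rcases h with ⟨hu, hv⟩ | ⟨hu, hv⟩
  · rw [checkLoss_of_nonneg p hu, checkLoss_of_nonneg p hv,
      checkLoss_of_nonneg p (by positivity)]
    ring
  · rw [checkLoss_of_nonpos p hu, checkLoss_of_nonpos p hv, checkLoss_of_nonpos p
      (add_nonpos (mul_nonpos_of_nonneg_of_nonpos ha hu) (mul_nonpos_of_nonneg_of_nonpos hb hv))]
    ring

/-- Equality in the convexity inequality forces the arguments to lie on the same half-line. -/
lemma same_sign_of_le_checkLoss_add {p a b u v : ℝ} (ha : 0 < a) (hb : 0 < b)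
    (h : a * checkLoss p u + b * checkLoss p v ≤ checkLoss p (a * u + b * v)) :
    0 ≤ u ∧ 0 ≤ v ∨ u ≤ 0 ∧ v ≤ 0 := by
  by_contra hcon
  rcases lt_trichotomy u 0 with hu | rfl | hu
  · have hv : 0 < v := by grind
    rw [checkLoss_of_nonpos p hu.le, checkLoss_of_nonneg p hv.le] at h
    have := mul_pos hb hv
    have := mul_neg_of_pos_of_neg ha hu
    rcases le_total 0 (a * u + b * v) with h' | h'
    · rw [checkLoss_of_nonneg p h'] at h; linarith
    · rw [checkLoss_of_nonpos p h'] at h; linarith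
  · grind
  · have hv : v < 0 := by grind
    rw [checkLoss_of_nonneg p hu.le, checkLoss_of_nonpos p hv.le] at h
    have := mul_pos ha hu
    have := mul_neg_of_pos_of_neg hb hv
    rcases le_total 0 (a * u + b * v) with h' | h'
    · rw [checkLoss_of_nonneg p h'] at h; linarith
    · rw [checkLoss_of_nonpos p h'] at h; linarith

/-! ### Scalar quantiles and unique minimization of `phi` -/

section Scalar

variable {N : ℕ} {Y Y' : Fin N → ℝ} {p t t' s : ℝ}

lemma phi_eq_sum_checkLoss (Y : Fin N → ℝ) (p t : ℝ) : phi Y p t = ∑ i, checkLoss p (Y i - t) :=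
  rfl

/-- Otherwise the largest data value strictly below the quantile would already belong to
`quantileSet`. -/
lemma card_lt_lowerQuantile (hN : 0 < N) (hp : p ∈ Set.Ioo (0 : ℝ) 1) :
    ((Finset.univ.filter fun i => Y i < lowerQuantile Y p).card : ℝ) < N * p := by
  by_contra! hcon
  have hpos : 0 < (Finset.univ.filter fun i => Y i < lowerQuantile Y p).card := by
    have : (0 : ℝ) < N * p := mul_pos (by exact_mod_cast hN) hp.1
    exact_mod_cast this.trans_le hcon
  obtain ⟨i, hi, hmax⟩ := Finset.exists_max_image _ Y (Finset.card_pos.mp hpos)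
  have hi' := (Finset.mem_filter.mp hi).2
  refine (not_le.mpr hi') ((isLeast_lowerQuantile hN Y hp.2.le).2 ⟨⟨i, rfl⟩, ?_⟩)
  rw [Int.ceil_le]
  refine hcon.trans ?_
  push_cast
  exact_mod_cast Finset.card_le_card fun j hj => by simpa using hmax j hj

lemma le_card_le_lowerQuantile (hN : 0 < N) (hp : p ∈ Set.Ioo (0 : ℝ) 1) :
    (N * p : ℝ) ≤ (Finset.univ.filter fun i => Y i ≤ lowerQuantile Y p).card := by
  have := Int.ceil_le.mp (isLeast_lowerQuantile hN Y hp.2.le).1.2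
  exact_mod_cast this

/-- The two counts characterize the quantile: they differ, so `t` is a data value, and any smaller
value has too few points below it. -/
lemma lowerQuantile_eq_of_card (h₁ : ((Finset.univ.filter fun i => Y i < t).card : ℝ) < N * p)
    (h₂ : (N * p : ℝ) ≤ (Finset.univ.filter fun i => Y i ≤ t).card) : lowerQuantile Y p = t := by
  refine IsLeast.csInf_eq ⟨⟨?_, ?_⟩, ?_⟩
  · by_contra hcon
    have : (Finset.univ.filter fun i => Y i ≤ t) = Finset.univ.filter fun i => Y i < t := by
      ext i
      simpa using ⟨fun h => lt_of_le_of_ne h fun h' => hcon ⟨i, h'⟩, le_of_lt⟩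
    rw [this] at h₂
    linarith
  · rw [Int.ceil_le]
    exact_mod_cast h₂
  · rintro a ⟨-, ha⟩
    by_contra! hcon
    have ha' := Int.ceil_le.mp ha
    have : (Finset.univ.filter fun i => Y i ≤ a).card ≤
        (Finset.univ.filter fun i => Y i < t).card :=
      Finset.card_le_card fun i hi => by
        simp only [Finset.mem_filter, Finset.mem_univ, true_and] at hi ⊢
        exact hi.trans_lt hcon
    have : ((Finset.univ.filter fun i => Y i ≤ a).card : ℝ) ≤
        (Finset.univ.filter fun i => Y i < t).card := by exact_mod_cast this
    push_cast at ha'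
    linarith

/-- The lower quantile only depends on the weak sign pattern of the residuals. -/
lemma lowerQuantile_eq_of_pattern (hN : 0 < N) (hp : p ∈ Set.Ioo (0 : ℝ) 1)
    (hle : ∀ i, Y i ≤ lowerQuantile Y p → Y' i ≤ t')
    (hge : ∀ i, lowerQuantile Y p ≤ Y i → t' ≤ Y' i) : lowerQuantile Y' p = t' := by
  refine lowerQuantile_eq_of_card (lt_of_le_of_lt ?_ (card_lt_lowerQuantile (Y := Y) hN hp))
    ((le_card_le_lowerQuantile (Y := Y) hN hp).trans ?_)
  · exact_mod_cast Finset.card_le_card fun i hi => by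
      simp only [Finset.mem_filter, Finset.mem_univ, true_and] at hi ⊢
      by_contra! h
      exact absurd (hge i h) (not_le.mpr hi)
  · exact_mod_cast Finset.card_le_card fun i hi => by
      simp only [Finset.mem_filter, Finset.mem_univ, true_and] at hi ⊢
      exact hle i hi

/-- Weak sign patterns survive the factor `0`, which is what later covers the normal `w = 0`. -/
lemma lowerQuantile_smul (hN : 0 < N) (hp : p ∈ Set.Ioo (0 : ℝ) 1) (Y : Fin N → ℝ) {a : ℝ}
    (ha : 0 ≤ a) : lowerQuantile (fun i => a * Y i) p = a * lowerQuantile Y p :=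
  lowerQuantile_eq_of_pattern (Y := Y) hN hp (fun _ h => mul_le_mul_of_nonneg_left h ha)
    fun _ h => mul_le_mul_of_nonneg_left h ha

lemma sum_ite_const_add (P : Fin N → Prop) [DecidablePred P] (α β : ℝ) :
    ∑ i, (if P i then α else β) =
      (α - β) * (Finset.univ.filter P).card + β * N := by
  have : ∀ i, (if P i then α else β) = (if P i then α - β else 0) + β := fun i => by
    split_ifs <;> ring
  simp_rw [this, Finset.sum_add_distrib, ← Finset.sum_filter]
  simp only [Finset.sum_const, nsmul_eq_mul, Finset.card_univ, Fintype.card_fin]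
  ring

/-- If `p N` is not an integer, then the lower quantile is the only minimizer of `phi`. -/
lemma phi_lowerQuantile_lt (hN : 0 < N) (hp : p ∈ Set.Ioo (0 : ℝ) 1)
    (hpN : ∀ m : ℤ, p * (N : ℝ) ≠ m) (hs : s ≠ lowerQuantile Y p) :
    phi Y p (lowerQuantile Y p) < phi Y p s := by
  have h₁ := card_lt_lowerQuantile (Y := Y) hN hp
  -- Non-integrality of `pN` makes this count strict; this is what gives uniqueness.
  have h₂ : (N * p : ℝ) < (Finset.univ.filter fun i => Y i ≤ lowerQuantile Y p).card :=
    lt_of_le_of_ne (le_card_le_lowerQuantile hN hp) fun h =>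
      hpN ((Finset.univ.filter fun i => Y i ≤ lowerQuantile Y p).card : ℤ) (by
        rw [mul_comm, h]; push_cast; rfl)
  generalize lowerQuantile Y p = t at *
  rw [phi_eq_sum_checkLoss, phi_eq_sum_checkLoss, ← sub_pos, ← Finset.sum_sub_distrib]
  rcases lt_or_gt_of_ne hs with h | h
  -- These termwise bounds sum to `(t - s) * (pN - #{Y < t})`, which is positive.
  · have hterm : ∀ i, (if Y i < t then (p - 1) * (t - s) else p * (t - s)) ≤
        checkLoss p (Y i - s) - checkLoss p (Y i - t) := fun i => by
      split_ifs with hi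
      · have := sub_one_mul_le_checkLoss (p := p) (Y i - s)
        rw [checkLoss_of_nonpos p (u := Y i - t) (by linarith)]
        linarith
      · rw [checkLoss_of_nonneg p (u := Y i - t) (by linarith),
          checkLoss_of_nonneg p (u := Y i - s) (by linarith)]
        linarith
    refine lt_of_lt_of_le ?_ (Finset.sum_le_sum fun i _ => hterm i)
    rw [sum_ite_const_add]
    nlinarith
  -- Here the bounds sum to `(s - t) * (#{Y ≤ t} - pN)`, again positive.
  · have hterm : ∀ i, (if Y i ≤ t then (1 - p) * (s - t) else -p * (s - t)) ≤
        checkLoss p (Y i - s) - checkLoss p (Y i - t) := fun i => by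
      split_ifs with hi
      · rw [checkLoss_of_nonpos p (u := Y i - t) (by linarith),
          checkLoss_of_nonpos p (u := Y i - s) (by linarith)]
        linarith
      · have := le_checkLoss (p := p) (Y i - s)
        rw [checkLoss_of_nonneg p (u := Y i - t) (by linarith)]
        linarith
    refine lt_of_lt_of_le ?_ (Finset.sum_le_sum fun i _ => hterm i)
    rw [sum_ite_const_add]
    nlinarith

lemma eq_lowerQuantile_of_phi_le (hN : 0 < N) (hp : p ∈ Set.Ioo (0 : ℝ) 1)
    (hpN : ∀ m : ℤ, p * (N : ℝ) ≠ m) (h : phi Y p s ≤ phi Y p (lowerQuantile Y p)) :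
    s = lowerQuantile Y p := by
  by_contra hs
  exact absurd (phi_lowerQuantile_lt hN hp hpN hs) (not_lt.mpr h)

end Scalar

/-! ### The orthant and the base of its dual cone -/

section Base

variable {n : ℕ} {c : Fin n → ℝ}

lemma mem_dualCone_orthant {w : Fin n → ℝ} : w ∈ dualCone (orthant n) ↔ 0 ≤ w := by
  simp only [dualCone, PointedCone.mem_dual, SetLike.mem_coe, orthant, PointedCone.mem_positive,
    dotProductBilin_apply_apply]
  refine ⟨fun h j => ?_, fun h y hy => dotProduct_nonneg_of_nonneg hy h⟩
  simpa using h (x := Pi.single j 1) (by simp)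

lemma pos_of_mem_interior_orthant (hc : c ∈ interior (orthant n : Set (Fin n → ℝ))) (j : Fin n) :
    0 < c j := by
  have : (orthant n : Set (Fin n → ℝ)) = Set.univ.pi fun _ => Set.Ici 0 := by
    ext x
    simp [orthant, Pi.le_def]
  rw [this, interior_pi_set Set.finite_univ] at hc
  simpa using hc j (Set.mem_univ j)

lemma mem_feasibleSet_orthant {x : (Fin n → ℝ) × ℝ} :
    x ∈ feasibleSet (orthant n) c ↔ (∀ j, 0 ≤ x.1 j) ∧ c ⬝ᵥ x.1 = 1 := by
  simp [feasibleSet, dualBase, mem_dualCone_orthant, Pi.le_def]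

/-- A point with nonzero last weight is determined by its first coordinates and its weighted sum. -/
lemma eq_of_dotProduct_eq {d : ℕ} {c w w' : Fin (d + 1) → ℝ} (hc : c (Fin.last d) ≠ 0)
    (h : ∀ j : Fin d, w j.castSucc = w' j.castSucc) (hw : c ⬝ᵥ w = c ⬝ᵥ w') : w = w' := by
  simp only [dotProduct, Fin.sum_univ_castSucc, h, add_right_inj] at hw
  funext j
  exact Fin.lastCases (mul_left_cancel₀ hc hw) h j

end Base

/-! ### Quantile pairs and cells of constant residual sign -/

/-- The residual `wᵀzⁱ - t` of the `i`-th data point. -/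
def residual {n N : ℕ} (Z : Fin N → Fin n → ℝ) (x : (Fin n → ℝ) × ℝ) (i : Fin N) : ℝ :=
  x.1 ⬝ᵥ Z i - x.2

/-- The objective `φ_{wᵀZ}(t)` as a function of the pair `(w, t)`. -/
def totalLoss {n N : ℕ} (Z : Fin N → Fin n → ℝ) (p : ℝ) (x : (Fin n → ℝ) × ℝ) : ℝ :=
  phi (scalarize x.1 Z) p x.2

/-- The pairs `(w, t)` for which `t` is the lower quantile of `wᵀZ`. -/
def IsQuantilePair {n N : ℕ} (Z : Fin N → Fin n → ℝ) (p : ℝ) (x : (Fin n → ℝ) × ℝ) : Prop :=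
  x.2 = lowerQuantile (scalarize x.1 Z) p

/-- The feasible pairs whose residuals have weakly the same signs as those of `x`. -/
def signCell {n N : ℕ} (Z : Fin N → Fin n → ℝ) (c : Fin n → ℝ) (x : (Fin n → ℝ) × ℝ) :
    Set ((Fin n → ℝ) × ℝ) :=
  {y | y ∈ feasibleSet (orthant n) c ∧ ∀ i, (0 ≤ residual Z x i → 0 ≤ residual Z y i) ∧
    (residual Z x i ≤ 0 → residual Z y i ≤ 0)}

section Pair

variable {n N : ℕ} {Z : Fin N → Fin n → ℝ} {p : ℝ} {c : Fin n → ℝ} {x y x₁ x₂ : (Fin n → ℝ) × ℝ}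
  {a b : ℝ}

lemma totalLoss_eq (Z : Fin N → Fin n → ℝ) (p : ℝ) (x : (Fin n → ℝ) × ℝ) :
    totalLoss Z p x = ∑ i, checkLoss p (residual Z x i) := rfl

lemma residual_add_smul (Z : Fin N → Fin n → ℝ) (x y : (Fin n → ℝ) × ℝ) (a b : ℝ) (i : Fin N) :
    residual Z (a • x + b • y) i = a * residual Z x i + b * residual Z y i := by
  simp only [residual, Prod.fst_add, Prod.smul_fst, add_dotProduct, smul_dotProduct, Prod.snd_add,
    Prod.smul_snd, smul_eq_mul]
  ring

lemma continuous_residual (Z : Fin N → Fin n → ℝ) (i : Fin N) :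
    Continuous fun x => residual Z x i := by
  unfold residual dotProduct
  fun_prop

lemma mem_signCell_self (hx : x ∈ feasibleSet (orthant n) c) : x ∈ signCell Z c x :=
  ⟨hx, fun _ => ⟨id, id⟩⟩

lemma IsQuantilePair.of_mem_signCell (hN : 0 < N) (hp : p ∈ Set.Ioo (0 : ℝ) 1)
    (hx : IsQuantilePair Z p x) (hy : y ∈ signCell Z c x) : IsQuantilePair Z p y := by
  refine (lowerQuantile_eq_of_pattern (Y := scalarize x.1 Z) hN hp ?_ ?_).symm <;>
    rw [← hx] <;> intro i hi
  · exact sub_nonpos.mp ((hy.2 i).2 (sub_nonpos.mpr hi))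
  · exact sub_nonneg.mp ((hy.2 i).1 (sub_nonneg.mpr hi))

/-- The quantile is a data value. The vanishing residual ties `t` to `w` throughout the sign cell.
-/
lemma IsQuantilePair.exists_residual_eq_zero (hN : 0 < N) (hp : p ∈ Set.Ioo (0 : ℝ) 1)
    (hx : IsQuantilePair Z p x) : ∃ i, residual Z x i = 0 := by
  obtain ⟨i, hi⟩ := (isLeast_lowerQuantile hN (scalarize x.1 Z) hp.2.le).1.1
  exact ⟨i, sub_eq_zero.mpr (hi.trans hx.symm)⟩

lemma IsQuantilePair.totalLoss_le (hN : 0 < N) (hp : p ∈ Set.Ioo (0 : ℝ) 1)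
    (hpN : ∀ m : ℤ, p * (N : ℝ) ≠ m) (hx : IsQuantilePair Z p x) (h : x.1 = y.1) :
    totalLoss Z p x ≤ totalLoss Z p y := by
  by_contra! hlt
  have := eq_lowerQuantile_of_phi_le (Y := scalarize y.1 Z) (s := y.2) hN hp hpN
    (by rw [← h, ← hx]; rw [totalLoss, totalLoss, ← h] at hlt; exact hlt.le)
  have hxy : x = y := Prod.ext h (by rw [this, ← h]; exact hx)
  exact lt_irrefl _ (hxy ▸ hlt)

lemma IsQuantilePair.eq_of_totalLoss_le (hN : 0 < N) (hp : p ∈ Set.Ioo (0 : ℝ) 1)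
    (hpN : ∀ m : ℤ, p * (N : ℝ) ≠ m) (hx : IsQuantilePair Z p x) (h : y.1 = x.1)
    (hle : totalLoss Z p y ≤ totalLoss Z p x) : y = x := by
  refine Prod.ext h ((eq_lowerQuantile_of_phi_le (Y := scalarize x.1 Z) hN hp hpN ?_).trans hx.symm)
  rw [totalLoss, h, totalLoss, hx] at hle
  exact hle

lemma convex_feasibleSet_orthant : Convex ℝ (feasibleSet (orthant n) c) := by
  intro x hx y hy a b ha hb hab
  rw [mem_feasibleSet_orthant] at *
  refine ⟨fun j => ?_, ?_⟩
  · have := mul_nonneg ha (hx.1 j)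
    have := mul_nonneg hb (hy.1 j)
    simp only [Prod.fst_add, Prod.smul_fst, Pi.add_apply, Pi.smul_apply, smul_eq_mul]
    linarith
  · simp [hx.2, hy.2, hab]

lemma convex_signCell : Convex ℝ (signCell Z c x) := by
  intro y hy y' hy' a b ha hb hab
  refine ⟨convex_feasibleSet_orthant hy.1 hy'.1 ha hb hab, fun i => ⟨fun h => ?_, fun h => ?_⟩⟩ <;>
    rw [residual_add_smul]
  · exact add_nonneg (mul_nonneg ha ((hy.2 i).1 h)) (mul_nonneg hb ((hy'.2 i).1 h))
  · exact add_nonpos (mul_nonpos_of_nonneg_of_nonpos ha ((hy.2 i).2 h))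
      (mul_nonpos_of_nonneg_of_nonpos hb ((hy'.2 i).2 h))

lemma isClosed_signCell : IsClosed (signCell Z c x) := by
  simp only [signCell, mem_feasibleSet_orthant, Set.ofPred_and, Set.ofPred_forall]
  refine ((isClosed_iInter fun j => isClosed_le continuous_const (by fun_prop)).inter
    (isClosed_eq (by unfold dotProduct; fun_prop) continuous_const)).inter
    (isClosed_iInter fun i => (isClosed_iInter fun _ => ?_).inter (isClosed_iInter fun _ => ?_))
  · exact isClosed_le continuous_const (continuous_residual Z i)
  · exact isClosed_le (continuous_residual Z i) continuous_const

/-- Positivity of `c` bounds each `w j` by `1 / c j`, and a residual vanishing on the whole cell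
makes `t` a continuous function of `w`. -/
lemma isCompact_signCell (hc : ∀ j, 0 < c j) (hN : 0 < N) (hp : p ∈ Set.Ioo (0 : ℝ) 1)
    (hx : IsQuantilePair Z p x) : IsCompact (signCell Z c x) := by
  obtain ⟨i, hi⟩ := hx.exists_residual_eq_zero hN hp
  have hcont : Continuous fun w : Fin n → ℝ => (w, w ⬝ᵥ Z i) := by
    unfold dotProduct
    fun_prop
  refine ((isCompact_Icc (a := (0 : Fin n → ℝ)) (b := fun j => 1 / c j)).image
    hcont).of_isClosed_subset isClosed_signCell fun y hy => ⟨y.1, ⟨?_, fun j => ?_⟩, ?_⟩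
  · exact (mem_feasibleSet_orthant.mp hy.1).1
  · obtain ⟨h₀, h₁⟩ := mem_feasibleSet_orthant.mp hy.1
    rw [le_div_iff₀ (hc j), mul_comm, ← h₁]
    exact Finset.single_le_sum (f := fun j => c j * y.1 j)
      (fun k _ => mul_nonneg (hc k).le (h₀ k)) (Finset.mem_univ j)
  · have : residual Z y i = 0 := le_antisymm ((hy.2 i).2 hi.le) ((hy.2 i).1 hi.ge)
    exact Prod.ext rfl (sub_eq_zero.mp this)

/-- If a quantile pair `x` is, up to its last entry, a proper convex combination of two pairs whose
losses average to at most the loss of `x`, then `x` is the convex combination itself and the two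
pairs have residuals of the same signs. -/
lemma IsQuantilePair.eq_of_le (hN : 0 < N) (hp : p ∈ Set.Ioo (0 : ℝ) 1)
    (hpN : ∀ m : ℤ, p * (N : ℝ) ≠ m) (hx : IsQuantilePair Z p x) (ha : 0 < a) (hb : 0 < b)
    (h : a • x₁.1 + b • x₂.1 = x.1)
    (hle : a * totalLoss Z p x₁ + b * totalLoss Z p x₂ ≤ totalLoss Z p x) :
    a • x₁ + b • x₂ = x ∧ ∀ i, 0 ≤ residual Z x₁ i ∧ 0 ≤ residual Z x₂ i ∨
      residual Z x₁ i ≤ 0 ∧ residual Z x₂ i ≤ 0 := by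
  have hterm : ∀ i ∈ Finset.univ, checkLoss p (residual Z (a • x₁ + b • x₂) i) ≤
      a * checkLoss p (residual Z x₁ i) + b * checkLoss p (residual Z x₂ i) := fun i _ => by
    rw [residual_add_smul]
    exact checkLoss_add_le _ _ ha.le hb.le
  have hsum : ∑ i, (a * checkLoss p (residual Z x₁ i) + b * checkLoss p (residual Z x₂ i)) =
      a * totalLoss Z p x₁ + b * totalLoss Z p x₂ := by
    simp only [totalLoss_eq, Finset.mul_sum, Finset.sum_add_distrib]
  have hsum_le : totalLoss Z p (a • x₁ + b • x₂) ≤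
      a * totalLoss Z p x₁ + b * totalLoss Z p x₂ := by
    rw [← hsum]
    exact Finset.sum_le_sum hterm
  -- The combination has the same `w` as `x` and no larger loss, so uniqueness of the minimizing `t`
  -- applies.
  have heq : a • x₁ + b • x₂ = x := hx.eq_of_totalLoss_le hN hp hpN h (hsum_le.trans hle)
  refine ⟨heq, fun i => same_sign_of_le_checkLoss_add (p := p) ha hb ?_⟩
  rw [← residual_add_smul]
  -- Equality of the sums forces equality in each termwise convexity bound.
  refine ((Finset.sum_eq_sum_iff_of_le hterm).mp ?_ i (Finset.mem_univ i)).ge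
  rw [hsum]
  refine le_antisymm hsum_le ?_
  rw [heq]
  exact hle

/-- The loss is additive along pairs with residuals of the same signs. -/
lemma totalLoss_add_smul (ha : 0 ≤ a) (hb : 0 ≤ b)
    (h : ∀ i, 0 ≤ residual Z x₁ i ∧ 0 ≤ residual Z x₂ i ∨
      residual Z x₁ i ≤ 0 ∧ residual Z x₂ i ≤ 0) :
    totalLoss Z p (a • x₁ + b • x₂) = a * totalLoss Z p x₁ + b * totalLoss Z p x₂ := by
  simp only [totalLoss_eq, Finset.mul_sum, ← Finset.sum_add_distrib]
  refine Finset.sum_congr rfl fun i _ => ?_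
  rw [residual_add_smul, checkLoss_add_of_same_sign ha hb (h i)]

end Pair

/-! ### Vertices of the extended image and solutions -/

/-- The feasible pairs whose objective value is a vertex of the extended image. -/
def vertexPairs {d N : ℕ} (Z : Fin N → Fin (d + 1) → ℝ) (c : Fin (d + 1) → ℝ) (p : ℝ) :
    Set ((Fin (d + 1) → ℝ) × ℝ) :=
  {x | x ∈ feasibleSet (orthant (d + 1)) c ∧
    dualObjective Z c p x ∈ (extendedImage Z (orthant (d + 1)) c p).extremePoints ℝ}

section Objective

variable {d N : ℕ} {Z : Fin N → Fin (d + 1) → ℝ} {p : ℝ} {c : Fin (d + 1) → ℝ}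
  {x y x₁ x₂ : (Fin (d + 1) → ℝ) × ℝ} {v : Fin (d + 1) → ℝ}

lemma dualObjective_castSucc (hc : ∀ j, 0 < c j) (j : Fin d) :
    dualObjective Z c p x j.castSucc = x.1 j.castSucc := by
  have := hc (Fin.last d)
  simp [dualObjective, abs_of_pos this, div_self this.ne']

lemma dualObjective_last :
    dualObjective Z c p x (Fin.last d) = totalLoss Z p x := by
  simp [dualObjective, totalLoss]

lemma dualObjective_eq_iff (hc : ∀ j, 0 < c j) :
    dualObjective Z c p x = v ↔
      (∀ j : Fin d, x.1 j.castSucc = v j.castSucc) ∧ totalLoss Z p x = v (Fin.last d) := by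
  rw [funext_iff, Fin.forall_fin_succ']
  simp only [dualObjective_castSucc hc, dualObjective_last]

lemma mem_extendedImage (hc : ∀ j, 0 < c j) :
    v ∈ extendedImage Z (orthant (d + 1)) c p ↔ ∃ x ∈ feasibleSet (orthant (d + 1)) c,
      (∀ j : Fin d, x.1 j.castSucc = v j.castSucc) ∧ totalLoss Z p x ≤ v (Fin.last d) := by
  simp only [extendedImage, Set.mem_add, Set.exists_mem_image]
  refine exists_congr fun x => and_congr_right fun _ => ⟨?_, fun h => ?_⟩
  · rintro ⟨k, hk, rfl⟩
    simp [dualObjective_castSucc hc, dualObjective_last, hk.1, hk.2]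
  · refine ⟨v - dualObjective Z c p x, ⟨fun j => ?_, ?_⟩, by abel⟩
    · simp [dualObjective_castSucc hc, h.1]
    · simp [dualObjective_last, h.2]

lemma fst_eq_of_castSucc_eq (hc : ∀ j, 0 < c j) (hx : x ∈ feasibleSet (orthant (d + 1)) c)
    (hy : y ∈ feasibleSet (orthant (d + 1)) c)
    (h : ∀ j : Fin d, x.1 j.castSucc = y.1 j.castSucc) : x.1 = y.1 :=
  eq_of_dotProduct_eq (hc _).ne' h
    ((mem_feasibleSet_orthant.mp hx).2.trans (mem_feasibleSet_orthant.mp hy).2.symm)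

/-- A vertex `v` above `D(x)` is the midpoint of `D(x)` and its reflection `2v - D(x)`, which also
lies above `D(x)`; extremality gives `v = D(x)`. -/
lemma exists_eq_dualObjective_of_mem_extremePoints (hc : ∀ j, 0 < c j)
    (hv : v ∈ (extendedImage Z (orthant (d + 1)) c p).extremePoints ℝ) :
    ∃ x ∈ feasibleSet (orthant (d + 1)) c, dualObjective Z c p x = v := by
  obtain ⟨x, hx, hcoord, hle⟩ := (mem_extendedImage hc).mp hv.1
  refine ⟨x, hx, hv.2 ((mem_extendedImage hc).mpr ⟨x, hx, fun j =>
    (dualObjective_castSucc hc j).symm, dualObjective_last.ge⟩)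
    (x₂ := (2 : ℝ) • v - dualObjective Z c p x) ((mem_extendedImage hc).mpr ⟨x, hx, fun j => ?_, ?_⟩)
    ⟨1 / 2, 1 / 2, by norm_num, by norm_num, by norm_num, ?_⟩⟩
  · simp only [Pi.sub_apply, Pi.smul_apply, smul_eq_mul, dualObjective_castSucc hc, hcoord]
    ring
  · simp only [Pi.sub_apply, Pi.smul_apply, smul_eq_mul, dualObjective_last]
    linarith
  · module

/-- Replacing `t` by the quantile moves the value down along `K`. The same reflection argument shows
that the value is unchanged, and uniqueness in `t` concludes. -/
lemma isQuantilePair_of_mem_vertexPairs (hc : ∀ j, 0 < c j) (hN : 0 < N)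
    (hp : p ∈ Set.Ioo (0 : ℝ) 1) (hpN : ∀ m : ℤ, p * (N : ℝ) ≠ m)
    (hx : x ∈ vertexPairs Z c p) : IsQuantilePair Z p x := by
  have hfeas := hx.1
  set y : (Fin (d + 1) → ℝ) × ℝ := (x.1, lowerQuantile (scalarize x.1 Z) p) with hy
  have hyq : IsQuantilePair Z p y := rfl
  have hyf : y ∈ feasibleSet (orthant (d + 1)) c := mem_feasibleSet_orthant.mpr
    (mem_feasibleSet_orthant.mp hfeas)
  have hle : totalLoss Z p y ≤ totalLoss Z p x := hyq.totalLoss_le hN hp hpN rfl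
  have hD : dualObjective Z c p y = dualObjective Z c p x := by
    refine hx.2.2 ((mem_extendedImage hc).mpr ⟨y, hyf, fun j =>
      (dualObjective_castSucc hc j).symm, dualObjective_last.ge⟩)
      (x₂ := (2 : ℝ) • dualObjective Z c p x - dualObjective Z c p y)
      ((mem_extendedImage hc).mpr ⟨y, hyf, fun j => ?_, ?_⟩)
      ⟨1 / 2, 1 / 2, by norm_num, by norm_num, by norm_num, by module⟩
    · simp only [Pi.sub_apply, Pi.smul_apply, smul_eq_mul, dualObjective_castSucc hc, hy]
      ring
    · simp only [Pi.sub_apply, Pi.smul_apply, smul_eq_mul, dualObjective_last]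
      linarith
  have hxy : x = y := hyq.eq_of_totalLoss_le hN hp hpN rfl
    (by rw [← dualObjective_last (c := c), ← hD, dualObjective_last])
  rw [hxy]
  exact hyq

lemma eq_of_dualObjective_eq (hc : ∀ j, 0 < c j)
    (hx : x ∈ feasibleSet (orthant (d + 1)) c) (hy : y ∈ feasibleSet (orthant (d + 1)) c)
    (hxq : IsQuantilePair Z p x) (hyq : IsQuantilePair Z p y)
    (h : dualObjective Z c p x = dualObjective Z c p y) : x = y := by
  have hfst : x.1 = y.1 := fst_eq_of_castSucc_eq hc hx hy fun j => by
    rw [← dualObjective_castSucc (Z := Z) (p := p) hc, h, dualObjective_castSucc hc]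
  exact Prod.ext hfst (by rw [hxq, hyq, hfst])

lemma isMinimizer_of_isQuantilePair (hc : ∀ j, 0 < c j) (hN : 0 < N)
    (hp : p ∈ Set.Ioo (0 : ℝ) 1) (hpN : ∀ m : ℤ, p * (N : ℝ) ≠ m)
    (hx : x ∈ feasibleSet (orthant (d + 1)) c) (hxq : IsQuantilePair Z p x) :
    IsMinimizer Z (orthant (d + 1)) c p x := by
  refine ⟨hx, fun y hy hxy => ?_⟩
  have hcoord : ∀ j : Fin d, x.1 j.castSucc = y.1 j.castSucc := fun j => by
    have := hxy.1 j
    rwa [Pi.sub_apply, dualObjective_castSucc hc, dualObjective_castSucc hc, sub_eq_zero] at this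
  have hle := hxy.2
  rw [Pi.sub_apply, dualObjective_last, dualObjective_last, sub_nonneg] at hle
  rw [hxq.eq_of_totalLoss_le hN hp hpN (fst_eq_of_castSucc_eq hc hx hy hcoord).symm hle]

lemma IsMinimizer.isQuantilePair (hc : ∀ j, 0 < c j) (hN : 0 < N)
    (hp : p ∈ Set.Ioo (0 : ℝ) 1) (hpN : ∀ m : ℤ, p * (N : ℝ) ≠ m)
    (hx : IsMinimizer Z (orthant (d + 1)) c p x) : IsQuantilePair Z p x := by
  set y : (Fin (d + 1) → ℝ) × ℝ := (x.1, lowerQuantile (scalarize x.1 Z) p) with hy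
  have hyq : IsQuantilePair Z p y := rfl
  have hyf : y ∈ feasibleSet (orthant (d + 1)) c := mem_feasibleSet_orthant.mpr
    (mem_feasibleSet_orthant.mp hx.1)
  have hD := hx.2 y hyf ⟨fun j => by
    simp [dualObjective_castSucc hc, hy], by
    rw [Pi.sub_apply, dualObjective_last, dualObjective_last, sub_nonneg]
    exact hyq.totalLoss_le hN hp hpN rfl⟩
  have hxy : x = y := hyq.eq_of_totalLoss_le hN hp hpN rfl
    (by rw [← dualObjective_last (c := c), ← hD, dualObjective_last])
  rw [hxy]
  exact hyq

/-- Extreme points of a cell of quantile pairs yield vertices of the extended image. -/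
lemma mem_vertexPairs_of_mem_extremePoints_signCell (hc : ∀ j, 0 < c j) (hN : 0 < N)
    (hp : p ∈ Set.Ioo (0 : ℝ) 1) (hpN : ∀ m : ℤ, p * (N : ℝ) ≠ m) (hx : IsQuantilePair Z p x)
    (hy : y ∈ (signCell Z c x).extremePoints ℝ) : y ∈ vertexPairs Z c p := by
  have hyq := hx.of_mem_signCell hN hp hy.1
  have hyf := hy.1.1
  refine ⟨hyf, (mem_extendedImage hc).mpr ⟨y, hyf, fun j =>
    (dualObjective_castSucc hc j).symm, dualObjective_last.ge⟩, ?_⟩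
  rintro v₁ hv₁ v₂ hv₂ ⟨a, b, ha, hb, hab, hv⟩
  obtain ⟨x₁, hx₁, hcoord₁, hle₁⟩ := (mem_extendedImage hc).mp hv₁
  obtain ⟨x₂, hx₂, hcoord₂, hle₂⟩ := (mem_extendedImage hc).mp hv₂
  have hv' := (dualObjective_eq_iff hc).mp hv.symm
  simp only [Pi.add_apply, Pi.smul_apply, smul_eq_mul] at hv'
  have hfst : (a • x₁ + b • x₂).1 = y.1 := fst_eq_of_castSucc_eq hc
    (convex_feasibleSet_orthant hx₁ hx₂ ha.le hb.le hab) hyf fun j => by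
      simp [hv'.1, hcoord₁, hcoord₂]
  have hle₁' := mul_le_mul_of_nonneg_left hle₁ ha.le
  have hle₂' := mul_le_mul_of_nonneg_left hle₂ hb.le
  obtain ⟨heq, hsign⟩ := hyq.eq_of_le hN hp hpN ha hb hfst (by linarith)
  have hres : ∀ i, residual Z y i = a * residual Z x₁ i + b * residual Z x₂ i := fun i => by
    rw [← heq, residual_add_smul]
  have hmem : x₁ ∈ signCell Z c x ∧ x₂ ∈ signCell Z c x := by
    have key : ∀ i, ((0 ≤ residual Z x i → 0 ≤ residual Z x₁ i) ∧
        (residual Z x i ≤ 0 → residual Z x₁ i ≤ 0)) ∧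
        ((0 ≤ residual Z x i → 0 ≤ residual Z x₂ i) ∧
        (residual Z x i ≤ 0 → residual Z x₂ i ≤ 0)) := fun i => by
      -- The residual of `y` is a positive combination of two numbers of one sign; if the cell
      -- demands the opposite sign, both must vanish.
      have h := hy.1.2 i
      rw [hres] at h
      rcases hsign i with ⟨h₁, h₂⟩ | ⟨h₁, h₂⟩
      · refine ⟨⟨fun _ => h₁, fun h' => ?_⟩, fun _ => h₂, fun h' => ?_⟩
        · nlinarith [h.2 h', mul_nonneg hb.le h₂]
        · nlinarith [h.2 h', mul_nonneg ha.le h₁]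
      · refine ⟨⟨fun h' => ?_, fun _ => h₁⟩, fun h' => ?_, fun _ => h₂⟩
        · nlinarith [h.1 h', mul_nonpos_of_nonneg_of_nonpos hb.le h₂]
        · nlinarith [h.1 h', mul_nonpos_of_nonneg_of_nonpos ha.le h₁]
    exact ⟨⟨hx₁, fun i => (key i).1⟩, ⟨hx₂, fun i => (key i).2⟩⟩
  obtain ⟨h₁, h₂⟩ := (mem_extremePoints.mp hy).2 x₁ hmem.1 x₂ hmem.2 ⟨a, b, ha, hb, hab, heq⟩
  rw [h₁] at hcoord₁ hle₁
  rw [h₂] at hle₂'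
  refine ((dualObjective_eq_iff hc).mpr ⟨hcoord₁, ?_⟩).symm
  -- Both last coordinates are at least the loss of `y` and average to it, so neither exceeds it.
  have : totalLoss Z p y = a * totalLoss Z p y + b * totalLoss Z p y := by
    rw [← add_mul, hab, one_mul]
  exact le_antisymm hle₁ (le_of_mul_le_mul_left (by linarith) ha)

/-- A closed half-space that contains all quantile pairs at vertices contains all quantile pairs. -/
lemma le_dotProduct_of_vertexPairs (hc : ∀ j, 0 < c j) (hN : 0 < N)
    (hp : p ∈ Set.Ioo (0 : ℝ) 1) (hpN : ∀ m : ℤ, p * (N : ℝ) ≠ m) {z : Fin (d + 1) → ℝ}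
    (hz : ∀ y ∈ vertexPairs Z c p, y.2 ≤ y.1 ⬝ᵥ z)
    (hxf : x ∈ feasibleSet (orthant (d + 1)) c) (hx : IsQuantilePair Z p x) :
    x.2 ≤ x.1 ⬝ᵥ z := by
  set H : Set ((Fin (d + 1) → ℝ) × ℝ) := {y | y.2 ≤ y.1 ⬝ᵥ z} with hH
  have hclosed : IsClosed H := isClosed_le continuous_snd (by unfold dotProduct; fun_prop)
  have hconvex : Convex ℝ H := by
    intro y hy y' hy' a b ha hb _
    simp only [hH, Set.mem_ofPred_eq] at hy hy' ⊢
    simp only [Prod.fst_add, Prod.smul_fst, add_dotProduct, smul_dotProduct, Prod.snd_add,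
      Prod.smul_snd, smul_eq_mul]
    exact add_le_add (mul_le_mul_of_nonneg_left hy ha) (mul_le_mul_of_nonneg_left hy' hb)
  have hsub : signCell Z c x ⊆ H := by
    -- Krein–Milman reduces the inclusion to the extreme points of the cell, which are vertex pairs.
    rw [← closure_convexHull_extremePoints (isCompact_signCell hc hN hp hx) convex_signCell]
    exact closure_minimal (convexHull_min (fun y hy => hz y
      (mem_vertexPairs_of_mem_extremePoints_signCell hc hN hp hpN hx hy)) hconvex) hclosed
  exact hsub (mem_signCell_self hxf)

/-- Extrapolating slightly beyond `u`, away from a number of the same sign, preserves the sign. -/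
lemma eventually_extrapolate_same_sign {u v : ℝ} (h : SignType.sign u = SignType.sign v) :
    ∀ᶠ ε in nhdsWithin (0 : ℝ) (Set.Ioi 0), (0 ≤ u → 0 ≤ (1 + ε) * u + -ε * v) ∧
      (u ≤ 0 → (1 + ε) * u + -ε * v ≤ 0) := by
  have hlim : Filter.Tendsto (fun ε : ℝ => (1 + ε) * u + -ε * v) (nhdsWithin 0 (Set.Ioi 0))
      (nhds u) := by
    have : Continuous fun ε : ℝ => (1 + ε) * u + -ε * v := by fun_prop
    simpa using (this.tendsto 0).mono_left nhdsWithin_le_nhds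
  rcases lt_trichotomy u 0 with hu | rfl | hu
  · filter_upwards [hlim.eventually (gt_mem_nhds hu)] with ε hε
    exact ⟨fun h => absurd h (not_le.mpr hu), fun _ => hε.le⟩
  · rw [sign_zero] at h
    simp [sign_eq_zero_iff.mp h.symm]
  · filter_upwards [hlim.eventually (lt_mem_nhds hu)] with ε hε
    exact ⟨fun _ => hε.le, fun h => absurd h (not_le.mpr hu)⟩

/-- A vertex is determined by the signs of its coordinates and residuals. -/
lemma eq_of_sign_eq (hc : ∀ j, 0 < c j) (hN : 0 < N)
    (hp : p ∈ Set.Ioo (0 : ℝ) 1) (hpN : ∀ m : ℤ, p * (N : ℝ) ≠ m)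
    (hx : x ∈ vertexPairs Z c p) (hy : y ∈ vertexPairs Z c p)
    (hcoord : ∀ j, SignType.sign (x.1 j) = SignType.sign (y.1 j))
    (hres : ∀ i, SignType.sign (residual Z x i) = SignType.sign (residual Z y i)) : x = y := by
  obtain ⟨ε, ⟨h₁, h₂⟩, hε⟩ := (((Filter.eventually_all.mpr fun j =>
    eventually_extrapolate_same_sign (hcoord j)).and (Filter.eventually_all.mpr fun i =>
    eventually_extrapolate_same_sign (hres i))).and self_mem_nhdsWithin).exists
  change 0 < ε at hε
  obtain ⟨hx₀, hx₁⟩ := mem_feasibleSet_orthant.mp hx.1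
  obtain ⟨hy₀, hy₁⟩ := mem_feasibleSet_orthant.mp hy.1
  -- Extrapolating beyond `x` away from `y` keeps feasibility and signs for small `ε`. The loss is
  -- then additive on the segment from `y'` to `y`, so `D(x)` lies strictly between `D(y')` and
  -- `D(y)`.
  set y' := (1 + ε) • x + (-ε) • y with hy'
  have hy'f : y' ∈ feasibleSet (orthant (d + 1)) c := mem_feasibleSet_orthant.mpr
    ⟨fun j => by simpa [hy'] using (h₁ j).1 (hx₀ j), by simp [hy', hx₁, hy₁]⟩
  have hpos : (0 : ℝ) < 1 + ε := by linarith
  have hxeq : (1 / (1 + ε)) • y' + (ε / (1 + ε)) • y = x := by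
    rw [hy', smul_add, smul_smul, smul_smul, add_assoc, ← add_smul]
    rw [show 1 / (1 + ε) * (1 + ε) = 1 by field_simp,
      show 1 / (1 + ε) * -ε + ε / (1 + ε) = 0 by field_simp; ring]
    simp
  have hab : 1 / (1 + ε) + ε / (1 + ε) = 1 := by field_simp
  have ha : 0 < 1 / (1 + ε) := by positivity
  have hb : 0 < ε / (1 + ε) := by positivity
  have hloss : totalLoss Z p x =
      1 / (1 + ε) * totalLoss Z p y' + ε / (1 + ε) * totalLoss Z p y := by
    rw [← totalLoss_add_smul ha.le hb.le fun i => ?_, hxeq]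
    rw [hy', residual_add_smul]
    rcases le_total 0 (residual Z x i) with h | h
    · refine Or.inl ⟨(h₂ i).1 h, ?_⟩
      rwa [← sign_nonneg_iff, ← hres, sign_nonneg_iff]
    · refine Or.inr ⟨(h₂ i).2 h, ?_⟩
      rwa [← sign_nonpos_iff, ← hres, sign_nonpos_iff]
  have hD : dualObjective Z c p y = dualObjective Z c p x := by
    refine ((mem_extremePoints.mp hx.2).2 (dualObjective Z c p y') ((mem_extendedImage hc).mpr
      ⟨y', hy'f, fun j => (dualObjective_castSucc hc j).symm, dualObjective_last.ge⟩) _ hy.2.1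
      ⟨1 / (1 + ε), ε / (1 + ε), ha, hb, hab, ?_⟩).2
    refine ((dualObjective_eq_iff hc).mpr ⟨fun j => ?_, ?_⟩).symm
    · rw [← hxeq]
      simp [dualObjective_castSucc hc]
    · rw [hloss]
      simp [dualObjective_last]
  exact (eq_of_dualObjective_eq hc hy.1 hx.1 (isQuantilePair_of_mem_vertexPairs hc hN hp hpN hy)
    (isQuantilePair_of_mem_vertexPairs hc hN hp hpN hx) hD).symm

lemma finite_vertexPairs (hc : ∀ j, 0 < c j) (hN : 0 < N)
    (hp : p ∈ Set.Ioo (0 : ℝ) 1) (hpN : ∀ m : ℤ, p * (N : ℝ) ≠ m) :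
    (vertexPairs Z c p).Finite := by
  refine Set.Finite.of_finite_image (f := fun x =>
    ((fun j => SignType.sign (x.1 j), fun i => SignType.sign (residual Z x i)) :
      (Fin (d + 1) → SignType) × (Fin N → SignType))) (Set.toFinite _) fun x hx y hy h => ?_
  rw [Prod.mk.injEq] at h
  exact eq_of_sign_eq hc hN hp hpN hx hy (congrFun h.1) (congrFun h.2)

lemma vertexPairs_subset_of_isSolution (hc : ∀ j, 0 < c j) (hN : 0 < N)
    (hp : p ∈ Set.Ioo (0 : ℝ) 1) (hpN : ∀ m : ℤ, p * (N : ℝ) ≠ m)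
    {T : Set ((Fin (d + 1) → ℝ) × ℝ)} (hT : IsSolution Z (orthant (d + 1)) c p T) :
    vertexPairs Z c p ⊆ T := by
  intro x hx
  obtain ⟨y, hyT, hyx⟩ := hT.covers hx.2
  have hy : y ∈ vertexPairs Z c p := ⟨hT.feasible hyT, hyx ▸ hx.2⟩
  rwa [eq_of_dualObjective_eq hc hx.1 hy.1 (isQuantilePair_of_mem_vertexPairs hc hN hp hpN hx)
    (isQuantilePair_of_mem_vertexPairs hc hN hp hpN hy) hyx.symm]

/-- A point outside `vertexPairs` covers no vertex and can be omitted, whereas a vertex pair is the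
only vertex pair with its value and cannot. -/
lemma isIrredundantSolution_iff (hc : ∀ j, 0 < c j) (hN : 0 < N)
    (hp : p ∈ Set.Ioo (0 : ℝ) 1) (hpN : ∀ m : ℤ, p * (N : ℝ) ≠ m)
    {T : Set ((Fin (d + 1) → ℝ) × ℝ)} :
    IsIrredundantSolution Z (orthant (d + 1)) c p T ↔ T = vertexPairs Z c p := by
  constructor
  · intro hT
    refine Set.Subset.antisymm (fun x hx => ?_)
      (vertexPairs_subset_of_isSolution hc hN hp hpN hT.toIsSolution)
    by_contra hxv
    refine hT.irredundant x hx fun v hv => ?_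
    obtain ⟨y, hy, rfl⟩ := hT.covers hv
    exact ⟨y, ⟨hy, fun h => hxv (h ▸ ⟨hT.feasible hy, hv⟩)⟩, rfl⟩
  · rintro rfl
    refine ⟨⟨finite_vertexPairs hc hN hp hpN, fun x hx => hx.1, fun v hv => ?_⟩,
      fun x hx hcov => ?_⟩
    · obtain ⟨x, hx, rfl⟩ := exists_eq_dualObjective_of_mem_extremePoints hc hv
      exact ⟨x, ⟨hx, hv⟩, rfl⟩
    · obtain ⟨y, ⟨hy, hne⟩, hyx⟩ := hcov hx.2
      exact hne (eq_of_dualObjective_eq hc hy.1 hx.1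
        (isQuantilePair_of_mem_vertexPairs hc hN hp hpN hy)
        (isQuantilePair_of_mem_vertexPairs hc hN hp hpN hx) hyx)

lemma coneQuantile_orthant_eq (hc : ∀ j, 0 < c j) (hN : 0 < N)
    (hp : p ∈ Set.Ioo (0 : ℝ) 1) (hpN : ∀ m : ℤ, p * (N : ℝ) ≠ m)
    {T : Set ((Fin (d + 1) → ℝ) × ℝ)} (hT : IsSolution Z (orthant (d + 1)) c p T)
    (hmin : ∀ x ∈ T, IsMinimizer Z (orthant (d + 1)) c p x) :
    coneQuantile Z (orthant (d + 1)) p = ⋂ x ∈ T, {z : Fin (d + 1) → ℝ | x.2 ≤ x.1 ⬝ᵥ z} := by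
  ext z
  simp only [coneQuantile, Set.mem_iInter, Set.mem_ofPred_eq, mem_dualCone_orthant]
  constructor
  · intro h x hx
    rw [(hmin x hx).isQuantilePair hc hN hp hpN]
    exact h x.1 (mem_feasibleSet_orthant.mp (hT.feasible hx)).1
  · intro h w hw
    set s := c ⬝ᵥ w with hs
    have hs₀ : 0 ≤ s := dotProduct_nonneg_of_nonneg (fun j => (hc j).le) hw
    -- Normalize `w` to the base by `s = cᵀw`. If `s = 0`, positivity of `c` forces `w = 0`, and the
    -- inequality is trivial.
    obtain ⟨w', hw', hle⟩ : ∃ w', s • w' = w ∧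
        s * lowerQuantile (scalarize w' Z) p ≤ s * (w' ⬝ᵥ z) := by
      rcases hs₀.eq_or_lt with h₀ | hpos
      · refine ⟨0, ?_, by simp [← h₀]⟩
        rw [smul_zero]
        rw [hs, dotProduct, eq_comm, Finset.sum_eq_zero_iff_of_nonneg fun j _ =>
          mul_nonneg (hc j).le (hw j)] at h₀
        exact funext fun j =>
          ((mul_eq_zero.mp (h₀ j (Finset.mem_univ j))).resolve_left (hc j).ne').symm
      · refine ⟨s⁻¹ • w, smul_inv_smul₀ hpos.ne' w, mul_le_mul_of_nonneg_left ?_ hs₀⟩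
        refine le_dotProduct_of_vertexPairs (c := c) (x := (s⁻¹ • w, _)) hc hN hp hpN
          (fun y hy => h y (vertexPairs_subset_of_isSolution hc hN hp hpN hT hy))
          (mem_feasibleSet_orthant.mpr ⟨fun j => ?_, ?_⟩) rfl
        · exact mul_nonneg (inv_nonneg.mpr hs₀) (hw j)
        · simp [← hs, hpos.ne']
    have hscal : scalarize (s • w') Z = fun i => s * scalarize w' Z i := by
      funext i
      simp [scalarize]
    rw [← hw', hscal, lowerQuantile_smul hN hp _ hs₀, smul_dotProduct]
    exact hle

end Objective

/-! ### Lifting Tukey depth regions to orthant quantiles -/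

section Lift

variable {d N : ℕ}

lemma dotProduct_snoc_neg_sum (w : Fin (d + 1) → ℝ) (z : Fin d → ℝ) :
    w ⬝ᵥ Fin.snoc (α := fun _ => ℝ) z (-∑ j, z j) = unlift w ⬝ᵥ z := by
  simp only [dotProduct, Fin.sum_univ_castSucc, Fin.snoc_castSucc, Fin.snoc_last, unlift, sub_mul,
    Finset.sum_sub_distrib, ← Finset.mul_sum]
  ring

lemma scalarize_liftData (w : Fin (d + 1) → ℝ) (X : Fin N → Fin d → ℝ) :
    scalarize w (liftData X) = scalarize (unlift w) X :=
  funext fun i => dotProduct_snoc_neg_sum w (X i)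

lemma exists_nonneg_unlift_eq (v : Fin d → ℝ) : ∃ w : Fin (d + 1) → ℝ, 0 ≤ w ∧ unlift w = v := by
  -- Adding a constant to all weights does not change `unlift`; `∑ |v k|` is large enough to make
  -- them nonnegative.
  refine ⟨Fin.snoc (α := fun _ => ℝ) (fun j => v j + ∑ k, |v k|) (∑ k, |v k|), ?_, ?_⟩
  · rw [Pi.le_def, Fin.forall_fin_succ']
    refine ⟨fun j => ?_, ?_⟩
    · have := Finset.single_le_sum (f := fun k => |v k|) (fun k _ => abs_nonneg _)
        (Finset.mem_univ j)
      have := neg_abs_le (v j)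
      simp only [Pi.zero_apply, Fin.snoc_castSucc] at *
      linarith
    · simpa using Finset.sum_nonneg fun k _ => abs_nonneg (v k)
  · funext j
    simp [unlift]

/-- The Tukey depth region is the preimage of the lower orthant quantile of the lifted data. -/
lemma mem_coneQuantile_bot_iff (X : Fin N → Fin d → ℝ) (p : ℝ) (z : Fin d → ℝ) :
    z ∈ coneQuantile X ⊥ p ↔ Fin.snoc (α := fun _ => ℝ) z (-∑ j, z j) ∈
      coneQuantile (liftData X) (orthant (d + 1)) p := by
  have hbot : ∀ v : Fin d → ℝ, v ∈ dualCone (⊥ : PointedCone ℝ (Fin d → ℝ)) := fun v => by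
    simp [dualCone]
  simp only [coneQuantile, Set.mem_iInter, Set.mem_ofPred_eq, mem_dualCone_orthant,
    dotProduct_snoc_neg_sum, scalarize_liftData]
  refine ⟨fun h w _ => h _ (hbot _), fun h v _ => ?_⟩
  obtain ⟨w, hw, rfl⟩ := exists_nonneg_unlift_eq v
  exact h w hw

end Lift

end ConeQuantile

end

theorem mainTheorem3 {d N : ℕ} (X : Fin N → Fin d → ℝ) (p : ℝ) (hp : p ∈ Set.Ioo (0 : ℝ) 1)
    (hpN : ∀ m : ℤ, p * (N : ℝ) ≠ (m : ℝ))
    (c : Fin (d + 1) → ℝ)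
    (hc : c ∈ interior (ConeQuantile.orthant (d + 1) : Set (Fin (d + 1) → ℝ))) :
    (∃! T : Set ((Fin (d + 1) → ℝ) × ℝ), ConeQuantile.IsIrredundantSolution
        (ConeQuantile.liftData X) (ConeQuantile.orthant (d + 1)) c p T) ∧
    (∀ T : Set ((Fin (d + 1) → ℝ) × ℝ),
      ConeQuantile.IsIrredundantSolution
        (ConeQuantile.liftData X) (ConeQuantile.orthant (d + 1)) c p T →
      ConeQuantile.coneQuantile X ⊥ p
        = ⋂ wt ∈ T, {z : Fin d → ℝ | wt.2 ≤ ConeQuantile.unlift wt.1 ⬝ᵥ z}) ∧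
    (∀ T : Set ((Fin (d + 1) → ℝ) × ℝ),
      ConeQuantile.IsSolution
        (ConeQuantile.liftData X) (ConeQuantile.orthant (d + 1)) c p T →
      (∀ wt ∈ T, ConeQuantile.IsMinimizer
        (ConeQuantile.liftData X) (ConeQuantile.orthant (d + 1)) c p wt) →
      ConeQuantile.coneQuantile (ConeQuantile.liftData X) (ConeQuantile.orthant (d + 1)) p
        = ⋂ wt ∈ T, {z : Fin (d + 1) → ℝ | wt.2 ≤ wt.1 ⬝ᵥ z} ∧
      ConeQuantile.coneQuantile X ⊥ p
        = ⋂ wt ∈ T, {z : Fin d → ℝ | wt.2 ≤ ConeQuantile.unlift wt.1 ⬝ᵥ z}) := by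
  -- An empty sample would make `pN = 0` an integer.
  have hN : 0 < N := Nat.pos_of_ne_zero fun h => hpN 0 (by simp [h])
  have hc' := ConeQuantile.pos_of_mem_interior_orthant hc
  have hiff := fun T => ConeQuantile.isIrredundantSolution_iff
    (Z := ConeQuantile.liftData X) (T := T) hc' hN hp hpN
  have hmain : ∀ T : Set ((Fin (d + 1) → ℝ) × ℝ),
      ConeQuantile.IsSolution
        (ConeQuantile.liftData X) (ConeQuantile.orthant (d + 1)) c p T →
      (∀ wt ∈ T, ConeQuantile.IsMinimizer
        (ConeQuantile.liftData X) (ConeQuantile.orthant (d + 1)) c p wt) →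
      ConeQuantile.coneQuantile (ConeQuantile.liftData X) (ConeQuantile.orthant (d + 1)) p
        = ⋂ wt ∈ T, {z : Fin (d + 1) → ℝ | wt.2 ≤ wt.1 ⬝ᵥ z} ∧
      ConeQuantile.coneQuantile X ⊥ p
        = ⋂ wt ∈ T, {z : Fin d → ℝ | wt.2 ≤ ConeQuantile.unlift wt.1 ⬝ᵥ z} := by
    intro T hT hmin
    have hlift := ConeQuantile.coneQuantile_orthant_eq hc' hN hp hpN hT hmin
    refine ⟨hlift, ?_⟩
    ext z
    rw [ConeQuantile.mem_coneQuantile_bot_iff, hlift]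
    simp only [Set.mem_iInter, Set.mem_ofPred_eq, ConeQuantile.dotProduct_snoc_neg_sum]
  refine ⟨⟨_, (hiff _).mpr rfl, fun T hT => (hiff T).mp hT⟩, fun T hT => ?_, hmain⟩
  refine (hmain T hT.toIsSolution fun x hx => ?_).2
  have hxv : x ∈ ConeQuantile.vertexPairs (ConeQuantile.liftData X) c p := (hiff T).mp hT ▸ hx
  exact ConeQuantile.isMinimizer_of_isQuantilePair hc' hN hp hpN hxv.1
    (ConeQuantile.isQuantilePair_of_mem_vertexPairs hc' hN hp hpN hxv)
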